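/- Let $\mathbb K$ be an infinite field, let $n,p,d$ be integers with $1\le p<n$ and $d\ge 1$, and let $I\subset \mathbb K[x_1,\dots,x_n]$ be an ideal. Let $I^{\mathrm{top}}$ be the homogeneous ideal generated by the top-degree homogeneous components of the elements of $I$ (so $I^{\mathrm{top}}=I$ if $I$ is homogeneous); the quotient $\mathbb K[x_1,\dots,x_n]/I^{\mathrm{top}}$ is the graded algebra associated with $\mathbb K[x_1,\dots,x_n]/I$. Let $H$ be the Hilbert series of $\mathbb K[x_1,\dots,x_n]/I^{\mathrm{top}}$, and for $e\ge 1$ let $HQ_e$ be the Hilbert series of $\mathbb K[x_1,\dots,x_n]/(I^{\mathrm{top}}+\langle x_n^e\rangle)$. The ideal $I$ is called a generic determinantal ideal (with parameters $n,p,d$) if the following three conditions hold. (1) $I$ is in shape position: its reduced lexicographic Gröbner basis for $x_1>\dots>x_n$ has the form $x_1-g_1(x_n),\dots,x_{n-1}-g_{n-1}(x_n),g_n(x_n)$ with $\deg g_n=\dim_{\mathbb K}\mathbb K[x_1,\dots,x_n]/I<\infty$. (2) $$H=\frac{\det P(t^{d-1})}{t^{(d-1)\binom{p-1}{2}}}\cdot\frac{(1-t^d)^p(1-t^{d-1})^{n-p}}{(1-t)^n},$$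 where $P(t)$ is the $(p-1)\times(p-1)$ matrix with $(i,j)$ entry $\sum_k\binom{p-i}{k}\binom{n-1-j}{k}t^k$. (3) $HQ_e=\left[(1-t^e)H\right]_+$ for all $e\ge 1$, where $[S]_+$ is the series $S$ truncated at its first non-positive coefficient. Let $I$ be a generic determinantal ideal, and let $G=(g_1,\dots,g_k)$ be the reduced (and minimal) Gröbner basis of $I$ for the degree reverse lexicographic (DRL) ordering with $x_1>\dots>x_n$. Let $E$ be the set of the monomials that are divisible by no leading monomial of an element of $G$. The monomials in $E$ form a basis of $\mathbb K[x_1,\dots,x_n]/I$; let $M_n$ be the matrix of multiplication by $x_n$ in this basis. Then, for every $b\in E$: - either $x_nb\in E$, and the column of $M_n$ indexed by $b$ is the unit vector with entry $1$ in row $x_nb$; - or $x_nb$ is the leading monomial of some $g\in G$, and the entry of this column in row $a\in E$ is the opposite of the coefficient of $a$ in $g$. Consequently, $M_n$ can be constructed from $G$ without performing any arithmetic operations. Precisely, there is one algorithm, independent of $\mathbb K,n,p,d,I,G$, which, given $n$ and the lists of the exponent vectors of the terms of the elements of $G$ (each list in decreasing DRL order), computes a list of the elements of $E$ and, for each pair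 $(a,b)\in E\times E$, a straight-line program that computes the entry $(a,b)$ of $M_n$ from the coefficients of the elements of $G$; the total number of additions, subtractions, multiplications and divisions in $\mathbb K$ in these programs is $0$ (copying a coefficient, the constants $0$ and $1$, and changes of sign are not counted). -/

import Mathlib

namespace DetIdeal

open MvPolynomial

/-! ### The degree reverse lexicographic ordering, `x_1 > x_2 > ... > x_n` -/

/-- Exponent vectors, to be ordered by the degree reverse lexicographic (DRL) ordering. -/
def DRLMon (n : ℕ) : Type := Fin n →₀ ℕ

namespace DRLMon

variable {n : ℕ}

noncomputable instance : AddCommMonoid (DRLMon n) := inferInstanceAs (AddCommMonoid (Fin n →₀ ℕ))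

/-- Comparison key: first the total degree, then the exponents read from the last variable to the
first one, a larger exponent making the monomial smaller. -/
def key (a : DRLMon n) : ℕ ×ₗ Lex (Fin n → ℕᵒᵈ) :=
  toLex (∑ i : Fin n, (show Fin n →₀ ℕ from a) i,
    toLex fun i : Fin n => OrderDual.toDual ((show Fin n →₀ ℕ from a) i.rev))

theorem key_injective : Function.Injective (key : DRLMon n → _) := by
  intro a b h
  have h2 : ∀ j : Fin n, (show Fin n →₀ ℕ from a) j.rev = (show Fin n →₀ ℕ from b) j.rev :=
    fun j => congrFun (congrArg (fun z : ℕ ×ₗ Lex (Fin n → ℕᵒᵈ) => ofLex (ofLex z).2) h) j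
  refine Finsupp.ext (fun i => ?_)
  have := h2 i.rev
  rwa [Fin.rev_rev] at this

noncomputable instance : LinearOrder (DRLMon n) := LinearOrder.lift' key key_injective

theorem lt_iff {a b : Fin n →₀ ℕ} :
    @LT.lt (DRLMon n) _ a b ↔
      ∑ i, a i < ∑ i, b i ∨
      (∑ i, a i = ∑ i, b i ∧ ∃ i, (∀ j, i < j → a j = b j) ∧ b i < a i) := by
  have h : @LT.lt (DRLMon n) _ a b ↔ key (n := n) a < key (n := n) b := Iff.rfl
  rw [h, Prod.Lex.lt_iff]
  refine or_congr Iff.rfl (and_congr Iff.rfl ?_)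
  constructor
  · rintro ⟨i, h1, h2⟩
    refine ⟨i.rev, fun j hj => ?_, h2⟩
    have := h1 j.rev (by simpa [Fin.rev_lt_iff] using hj)
    simpa [key] using this
  · rintro ⟨i, h1, h2⟩
    refine ⟨i.rev, fun j hj => ?_, ?_⟩
    · have := h1 j.rev (by simpa [Fin.lt_rev_iff] using hj)
      simpa [key] using this
    · show OrderDual.toDual (a i.rev.rev) < OrderDual.toDual (b i.rev.rev)
      simpa using h2

theorem add_lt_add {a b : Fin n →₀ ℕ} (c : Fin n →₀ ℕ) (h : @LT.lt (DRLMon n) _ a b) :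
    @LT.lt (DRLMon n) _ (c + a : Fin n →₀ ℕ) (c + b : Fin n →₀ ℕ) := by
  rw [lt_iff] at h ⊢
  simpa [Finset.sum_add_distrib] using h

instance : IsOrderedAddMonoid (DRLMon n) where
  add_le_add_left a b hab c := by
    rcases hab.lt_or_eq with h | h
    · have := add_lt_add (n := n) c h
      rw [add_comm a c, add_comm b c]
      exact this.le
    · rw [h]

theorem monotone_id {a b : Fin n →₀ ℕ} (h : a ≤ b) : @LE.le (DRLMon n) _ a b := by
  rcases eq_or_ne a b with rfl | hne
  · exact le_refl (α := DRLMon n) a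
  · refine le_of_lt (α := DRLMon n) (lt_iff.2 (Or.inl ?_))
    obtain ⟨i, hi⟩ : ∃ i, a i ≠ b i := by
      by_contra hc
      push Not at hc
      exact hne (Finsupp.ext hc)
    exact Finset.sum_lt_sum (fun i _ => h i) ⟨i, Finset.mem_univ i, lt_of_le_of_ne (h i) hi⟩

instance : WellFoundedLT (DRLMon n) := by
  have h : WellQuasiOrderedLE (DRLMon n) :=
    ⟨WellQuasiOrdered.of_surjective (wellQuasiOrdered_le (α := Fin n →₀ ℕ))
      ⟨fun a => (a : DRLMon n), fun h => monotone_id h⟩ (fun a => ⟨a, rfl⟩)⟩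
  infer_instance

end DRLMon

/-- The DRL monomial ordering in `n` variables, the last variable being the least one. -/
noncomputable def drl (n : ℕ) : MonomialOrder (Fin n) where
  syn := DRLMon n
  toSyn := { toFun := fun a => a, invFun := fun a => a, map_add' := fun _ _ => rfl }
  toSyn_monotone := fun _ _ h => DRLMon.monotone_id h

theorem drl_lt_iff {n : ℕ} (a b : Fin n →₀ ℕ) :
    (drl n).toSyn a < (drl n).toSyn b ↔
      ∑ i, a i < ∑ i, b i ∨
      (∑ i, a i = ∑ i, b i ∧ ∃ i, (∀ j, i < j → a j = b j) ∧ b i < a i) :=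
  DRLMon.lt_iff

/-! ### Gröbner bases and staircases -/

section Groebner

variable {n : ℕ} {K : Type*} [Field K]

/-- `G` is a Gröbner basis of `I`: a finite subset of `I` such that the leading monomial of every
nonzero element of `I` is divisible by the leading monomial of an element of `G`. -/
def IsGroebnerBasis (m : MonomialOrder (Fin n)) (G : Set (MvPolynomial (Fin n) K))
    (I : Ideal (MvPolynomial (Fin n) K)) : Prop :=
  G.Finite ∧ G ⊆ I ∧ ∀ f ∈ I, f ≠ 0 → ∃ g ∈ G, g ≠ 0 ∧ m.degree g ≤ m.degree f

/-- `G` is the reduced (hence minimal) Gröbner basis of `I`: its elements are monic, and no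
monomial of an element of `G` is divisible by the leading monomial of another element. -/
def IsReducedGroebnerBasis (m : MonomialOrder (Fin n)) (G : Set (MvPolynomial (Fin n) K))
    (I : Ideal (MvPolynomial (Fin n) K)) : Prop :=
  IsGroebnerBasis m G I ∧ (∀ g ∈ G, m.leadingCoeff g = 1) ∧
    ∀ g ∈ G, ∀ g' ∈ G, g' ≠ g → ∀ s ∈ g.support, ¬ m.degree g' ≤ s

/-- The staircase of `G`: the monomials divisible by no leading monomial of an element of `G`. -/
def staircase (m : MonomialOrder (Fin n)) (G : Set (MvPolynomial (Fin n) K)) :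
    Set (Fin n →₀ ℕ) :=
  {r | ∀ g ∈ G, ¬ m.degree g ≤ r}

end Groebner

/-! ### Generic determinantal ideals -/

/-- The index of the last variable `x_n`. -/
def lastVar (n : ℕ) [NeZero n] : Fin n := ⟨n - 1, Nat.sub_lt (NeZero.pos n) one_pos⟩

section Generic

variable {n : ℕ} {K : Type*} [Field K]

/-- Shape position: for the lexicographic ordering with `x_1 > ... > x_n`, the reduced Gröbner
basis of `I` is `x_1 - g_1(x_n), ..., x_{n-1} - g_{n-1}(x_n), g_n(x_n)`, and the degree of `g_n`
is the degree of `I`, that is, the dimension of the quotient algebra. -/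
def IsInShapePosition [NeZero n] (I : Ideal (MvPolynomial (Fin n) K)) : Prop :=
  ∃ g : Fin n → Polynomial K,
    IsReducedGroebnerBasis MonomialOrder.lex
      (Set.range fun i : Fin n =>
        if i = lastVar n then Polynomial.aeval (X (lastVar n) : MvPolynomial (Fin n) K) (g i)
        else X i - Polynomial.aeval (X (lastVar n) : MvPolynomial (Fin n) K) (g i)) I ∧
    FiniteDimensional K (MvPolynomial (Fin n) K ⧸ I) ∧
    (g (lastVar n)).natDegree = Module.finrank K (MvPolynomial (Fin n) K ⧸ I)

/-- The ideal generated by the homogeneous components of top degree of the elements of `I`. The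
graded algebra associated with `K[x]/I`, filtered by the degree, is the quotient of `K[x]` by
this ideal; it is `I` itself when `I` is homogeneous. -/
noncomputable def topIdeal (I : Ideal (MvPolynomial (Fin n) K)) :
    Ideal (MvPolynomial (Fin n) K) :=
  Ideal.span ((fun f => homogeneousComponent f.totalDegree f) '' (I : Set (MvPolynomial (Fin n) K)))

/-- The Hilbert series of `K[x]/J` for a homogeneous ideal `J`: its `k`th coefficient is the
dimension of the image in `K[x]/J` of the space of homogeneous polynomials of degree `k`. -/
noncomputable def hilbertSeries (J : Ideal (MvPolynomial (Fin n) K)) : PowerSeries ℤ :=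
  PowerSeries.mk fun k =>
    (Module.finrank K
      ((homogeneousSubmodule (Fin n) K k).map (Ideal.Quotient.mkₐ K J).toLinearMap) : ℤ)

/-- `[S]_+`: the series `S` truncated at its first non-positive coefficient. -/
noncomputable def truncPos (S : PowerSeries ℤ) : PowerSeries ℤ :=
  open Classical in
  PowerSeries.mk fun k =>
    if ∀ j ≤ k, 0 < PowerSeries.coeff j S then PowerSeries.coeff k S else 0

/-- The `(p-1) × (p-1)` matrix `P(s)`, whose `(i, j)` entry, `1 ≤ i, j ≤ p-1`, is
`∑_k binom(p-i, k) binom(n-1-j, k) s^k`. -/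
noncomputable def matP (n p : ℕ) (s : PowerSeries ℤ) :
    Matrix (Fin (p - 1)) (Fin (p - 1)) (PowerSeries ℤ) :=
  Matrix.of fun i j => ∑ k ∈ Finset.range (p + 1),
    (((p - (i + 1 : ℕ)).choose k * (n - 1 - (j + 1 : ℕ)).choose k : ℕ) : PowerSeries ℤ) * s ^ k

/-- `H = det P(t^(d-1)) / t^((d-1) binom(p-1, 2)) * (1 - t^d)^p (1 - t^(d-1))^(n-p) / (1-t)^n`,
written without denominators. -/
def IsDeterminantalSeries (n p d : ℕ) (H : PowerSeries ℤ) : Prop :=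
  H * PowerSeries.X ^ ((d - 1) * (p - 1).choose 2) * (1 - PowerSeries.X) ^ n =
    (matP n p (PowerSeries.X ^ (d - 1))).det * (1 - PowerSeries.X ^ d) ^ p *
      (1 - PowerSeries.X ^ (d - 1)) ^ (n - p)

/-- Generic determinantal ideals with parameters `n, p, d`. The Hilbert series are those of the
graded algebra associated with `K[x]/I` and of its quotients by the powers of `x_n`. -/
structure IsGenericDeterminantal [NeZero n] (p d : ℕ) (I : Ideal (MvPolynomial (Fin n) K)) :
    Prop where
  shape : IsInShapePosition I
  hilbert : IsDeterminantalSeries n p d (hilbertSeries (topIdeal I))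
  froberg : ∀ e : ℕ, 1 ≤ e →
    hilbertSeries (topIdeal I ⊔ Ideal.span {(X (lastVar n) : MvPolynomial (Fin n) K) ^ e}) =
      truncPos ((1 - PowerSeries.X ^ e) * hilbertSeries (topIdeal I))

/-- The matrix of the multiplication by `x_n` in `K[x]/I`, in the basis `B`: the column of `b`
holds the coordinates of `x_n * B b`. -/
noncomputable def multMatrix [NeZero n] {I : Ideal (MvPolynomial (Fin n) K)} {E : Type*}
    (B : Module.Basis E K (MvPolynomial (Fin n) K ⧸ I)) : Matrix E E K :=
  Matrix.of fun a b => B.repr (Ideal.Quotient.mk I (X (lastVar n)) * B b) a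

end Generic

/-! ### Straight-line programs over a field, with a count of the arithmetic operations -/

/-- Instructions. Each instruction writes one new register; `r` and `s` are indices of registers
written before. `input i j` copies the coefficient of the `j`th term of the `i`th input
polynomial. -/
inductive Instr : Type
  | zero
  | one
  | input (i j : ℕ)
  | neg (r : ℕ)
  | add (r s : ℕ)
  | sub (r s : ℕ)
  | mul (r s : ℕ)
  | div (r s : ℕ)

/-- Coding of the instructions by standard data, used only to speak of computable functions. -/
def instrEquiv : Instr ≃ (Bool ⊕ ℕ) ⊕ (Fin 5 × ℕ × ℕ) where
  toFun
    | .zero => .inl (.inl false)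
    | .one => .inl (.inl true)
    | .neg r => .inl (.inr r)
    | .input i j => .inr (0, i, j)
    | .add r s => .inr (1, r, s)
    | .sub r s => .inr (2, r, s)
    | .mul r s => .inr (3, r, s)
    | .div r s => .inr (4, r, s)
  invFun
    | .inl (.inl false) => .zero
    | .inl (.inl true) => .one
    | .inl (.inr r) => .neg r
    | .inr (0, i, j) => .input i j
    | .inr (1, r, s) => .add r s
    | .inr (2, r, s) => .sub r s
    | .inr (3, r, s) => .mul r s
    | .inr (4, r, s) => .div r s
  left_inv := by rintro (_ | _ | _ | _ | _ | _ | _ | _) <;> rfl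
  right_inv := by
    rintro ((b | r) | ⟨o, r, s⟩)
    · cases b <;> rfl
    · rfl
    · fin_cases o <;> rfl

instance : Primcodable Instr := Primcodable.ofEquiv _ instrEquiv

/-- The cost of an instruction: additions, subtractions, multiplications and divisions in the
field are counted; copies of input coefficients, the constants `0` and `1`, and changes of sign
are not. -/
def Instr.cost : Instr → ℕ
  | .zero => 0
  | .one => 0
  | .input _ _ => 0
  | .neg _ => 0
  | .add _ _ => 1
  | .sub _ _ => 1
  | .mul _ _ => 1
  | .div _ _ => 1

/-- The value written by an instruction, given the input coefficients `c` and the registers. It is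
undefined when an argument is missing or a divisor is zero. -/
noncomputable def Instr.exec {K : Type*} [Field K] (c : ℕ → ℕ → Option K) (regs : List K) :
    Instr → Option K
  | .zero => some 0
  | .one => some 1
  | .input i j => c i j
  | .neg r => regs[r]?.map fun x => -x
  | .add r s => regs[r]?.bind fun x => regs[s]?.map fun y => x + y
  | .sub r s => regs[r]?.bind fun x => regs[s]?.map fun y => x - y
  | .mul r s => regs[r]?.bind fun x => regs[s]?.map fun y => x * y
  | .div r s => open Classical in
      regs[r]?.bind fun x => regs[s]?.bind fun y => if y = 0 then none else some (x / y)

/-- The number of arithmetic operations of a straight-line program. -/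
def progCost (P : List Instr) : ℕ := (P.map Instr.cost).sum

/-- The list of registers after the execution of a straight-line program. -/
noncomputable def progRun {K : Type*} [Field K] (c : ℕ → ℕ → Option K) (P : List Instr) :
    Option (List K) :=
  P.foldlM (fun regs a => (a.exec c regs).map fun x => regs ++ [x]) []

/-- The output of a straight-line program: the content of the last register. -/
noncomputable def progOutput {K : Type*} [Field K] (c : ℕ → ℕ → Option K) (P : List Instr) :
    Option K :=
  (progRun c P).bind List.getLast?

/-! ### Algorithms that build a matrix from a list of polynomials -/

/-- The monomial data of a list of polynomials: the number of variables and, for each polynomial,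
the list of the exponent vectors of its terms. -/
abbrev MonData : Type := ℕ × List (List (List ℕ))

/-- An algorithm that builds a square matrix, whose rows and columns are indexed by monomials, from
a list of polynomials. From the monomial data alone it determines the list of the monomials that
index the matrix and, for a row `a` and a column `b`, a straight-line program that computes the
entry from the coefficients of the polynomials. -/
structure MatrixAlgorithm where
  index : MonData → List (List ℕ)
  entry : MonData × List ℕ × List ℕ → List Instr
  index_computable : Computable index
  entry_computable : Computable entry

/-- The number of arithmetic operations spent on the whole matrix. -/
def MatrixAlgorithm.arithOps (A : MatrixAlgorithm) (D : MonData) : ℕ :=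
  ((A.index D).map fun a => ((A.index D).map fun b => progCost (A.entry (D, a, b))).sum).sum

section Input

variable {n : ℕ} {K : Type*} [Field K]

/-- The exponent vector of a monomial, as a list. -/
def expList (a : Fin n →₀ ℕ) : List ℕ := List.ofFn fun i => a i

/-- The monomials of `g` in decreasing DRL order. -/
noncomputable def monList (g : MvPolynomial (Fin n) K) : List (Fin n →₀ ℕ) :=
  ((g.support.map (drl n).toSyn.toEquiv.toEmbedding).sort (· ≥ ·)).map (drl n).toSyn.symm

/-- The monomial data of a list of polynomials. -/
noncomputable def monData (G : List (MvPolynomial (Fin n) K)) : MonData :=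
  (n, G.map fun g => (monList g).map expList)

/-- The coefficients of a list of polynomials, in the order of the monomial data. -/
noncomputable def coeffData (G : List (MvPolynomial (Fin n) K)) (i j : ℕ) : Option K :=
  G[i]?.bind fun g => (monList g)[j]?.map fun s => g.coeff s

/-- The algorithm `A`, on the input `G`, constructs the matrix `M` indexed by the set `E` of
monomials. -/
def MatrixAlgorithm.Constructs (A : MatrixAlgorithm) (G : List (MvPolynomial (Fin n) K))
    {E : Set (Fin n →₀ ℕ)} (M : Matrix E E K) : Prop :=
  (A.index (monData G)).Nodup ∧
  (∀ l : List ℕ, l ∈ A.index (monData G) ↔ ∃ a ∈ E, l = expList a) ∧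
  ∀ a b : E, progOutput (coeffData G) (A.entry (monData G, expList a.1, expList b.1)) =
    some (M a b)

end Input

end DetIdeal

open DetIdeal

/-! Write `E` for the set of standard monomials. The point is that if `b ∈ E` and `x_n b ∉ E`, then
every proper divisor of `x_n b` lies in `E`; so `x_n b` is a minimal leading monomial, hence that of
an element `g` of the basis, and modulo `I` it equals minus the tail of `g`.

Two features of DRL turn the Hilbert series into counts. It compares degrees first, so `I` and its
top ideal have the same standard monomials (`stdMons_topIdeal`). In a fixed degree it prefers small
powers of `x_n`, so adding `x_n^e` to a homogeneous ideal only removes the standard monomials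
divisible by `x_n^e` (`stdMons_sup_span_X_pow`). The identity for `HQ_e` then gives a dichotomy in
each degree `k`: either multiplication by `x_n^e` keeps all of `E_k` inside `E`, or it produces
every element of `E_{k+e}` (`le_lastVar_of_froberg`). Choosing `e` as one more than the exponent of
`x_n` in `b` gives minimality (`mem_or_isMinimal`).

The algorithm only searches lists: a leading monomial is the head of its list, `E` lies in a box
bounded by the leading exponents, and each entry is 0, 1, or a negated copy of a coefficient. -/

namespace DetIdeal

open MvPolynomial

attribute [local instance] MvPolynomial.gradedAlgebra

/-! ### Standard monomials and normal forms -/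

section StandardMonomials

variable {n : ℕ} {K : Type*} [Field K]

/-- The standard monomials of an ideal: those that are the leading monomial of no nonzero element
of the ideal. -/
def stdMons (m : MonomialOrder (Fin n)) (J : Ideal (MvPolynomial (Fin n) K)) :
    Set (Fin n →₀ ℕ) :=
  {s | ∀ f ∈ J, f ≠ 0 → m.degree f ≠ s}

variable {m : MonomialOrder (Fin n)} {J : Ideal (MvPolynomial (Fin n) K)}

theorem eq_zero_of_support_subset_stdMons {f : MvPolynomial (Fin n) K} (hf : f ∈ J)
    (hs : ∀ s ∈ f.support, s ∈ stdMons m J) : f = 0 := by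
  by_contra h
  exact hs _ (m.degree_mem_support h) f hf h rfl

theorem exists_normalForm (m : MonomialOrder (Fin n)) (J : Ideal (MvPolynomial (Fin n) K))
    (f : MvPolynomial (Fin n) K) :
    ∃ r, f - r ∈ J ∧ ∀ s ∈ r.support, s ∈ stdMons m J := by
  -- Dividing by all nonzero elements of `J` at once removes every leading monomial of `J` from the
  -- remainder; no Gröbner basis is needed.
  obtain ⟨q, r, h1, -, h3⟩ := m.div_set (B := {g | g ∈ J ∧ g ≠ 0})
    (fun b hb => (isUnit_iff_ne_zero.2 (m.leadingCoeff_ne_zero_iff.2 hb.2))) f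
  refine ⟨r, ?_, fun s hs g hg hg0 he => h3 s hs g ⟨hg, hg0⟩ he.le⟩
  rw [h1, add_sub_cancel_right, Finsupp.linearCombination_apply]
  exact Ideal.sum_mem _ fun b _ => J.mul_mem_left _ b.2.1

theorem mem_stdMons_of_le {s t : Fin n →₀ ℕ} (hst : s ≤ t) (ht : t ∈ stdMons m J) :
    s ∈ stdMons m J := by
  rintro f hf hf0 rfl
  refine ht (monomial (t - m.degree f) 1 * f) (J.mul_mem_left _ hf)
    (mul_ne_zero (by simp) hf0) ?_
  classical
  rw [m.degree_mul (by simp) hf0, m.degree_monomial, if_neg one_ne_zero, tsub_add_cancel_of_le hst]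

theorem monomial_notMem_of_mem_stdMons {s : Fin n →₀ ℕ} (hs : s ∈ stdMons m J) :
    (monomial s (1 : K)) ∉ J := by
  intro h
  refine hs _ h (by simp) ?_
  classical
  rw [m.degree_monomial, if_neg one_ne_zero]

theorem stdMons_anti {J' : Ideal (MvPolynomial (Fin n) K)} (h : J ≤ J') :
    stdMons m J' ⊆ stdMons m J :=
  fun _ hs f hf => hs f (h hf)

theorem linearIndependent_monomial {S : Set (Fin n →₀ ℕ)} (hS : S ⊆ stdMons m J) :
    LinearIndependent K (fun s : S => Ideal.Quotient.mk J (monomial s.1 (1 : K))) := by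
  have h := ((MvPolynomial.basisMonomials (Fin n) K).linearIndependent.comp
    (fun s : S => s.1) Subtype.val_injective).map (f := (Ideal.Quotient.mkₐ K J).toLinearMap) ?_
  · simpa [Function.comp_def] using h
  rw [Submodule.disjoint_def]
  intro f hf hfJ
  have hf' : f ∈ restrictSupport K S := by
    rw [restrictSupport_eq_span, Set.image_eq_range]
    simpa [Function.comp_def] using hf
  refine eq_zero_of_support_subset_stdMons (m := m) (J := J) ?_ fun s hs => hS ?_
  · simpa [Ideal.Quotient.eq_zero_iff_mem] using hfJ
  · exact ((mem_restrictSupport_iff K).1 hf') hs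

theorem mk_mem_span_monomial {S : Set (Fin n →₀ ℕ)} {r : MvPolynomial (Fin n) K}
    (hr : ∀ s ∈ r.support, s ∈ S) :
    Ideal.Quotient.mk J r ∈
      Submodule.span K (Set.range fun s : S => Ideal.Quotient.mk J (monomial s.1 (1 : K))) := by
  have h : r ∈ restrictSupport K S := (mem_restrictSupport_iff K).2 hr
  rw [restrictSupport_eq_span, Set.image_eq_range] at h
  have := Submodule.mem_map_of_mem (f := (Ideal.Quotient.mkₐ K J).toLinearMap) h
  rw [Submodule.map_span, ← Set.range_comp] at this
  exact this

/-- The elements of `G` must be nonzero because `m.degree 0 = 0`: a zero element would empty the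
staircase. -/
theorem staircase_eq_stdMons {G : Set (MvPolynomial (Fin n) K)}
    (hG : IsGroebnerBasis m G J) (h0 : ∀ g ∈ G, g ≠ 0) : staircase m G = stdMons m J := by
  ext s
  constructor
  · rintro hs f hf hf0 rfl
    obtain ⟨g, hg, -, hle⟩ := hG.2.2 f hf hf0
    exact hs g hg hle
  · intro hs g hg hle
    exact mem_stdMons_of_le hle hs g (hG.2.1 hg) (h0 g hg) rfl

/-- The basis of the quotient formed by the standard monomials. -/
noncomputable def stdBasis {S : Set (Fin n →₀ ℕ)} (hS : S = stdMons m J) :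
    Module.Basis S K (MvPolynomial (Fin n) K ⧸ J) :=
  Module.Basis.mk (linearIndependent_monomial hS.le) (by
    rintro x -
    obtain ⟨f, rfl⟩ := Ideal.Quotient.mk_surjective x
    obtain ⟨r, hr, hs⟩ := exists_normalForm m J f
    rw [Ideal.Quotient.eq.2 hr]
    exact mk_mem_span_monomial (hS ▸ hs))

theorem stdBasis_apply {S : Set (Fin n →₀ ℕ)} (hS : S = stdMons m J) (s : S) :
    stdBasis hS s = Ideal.Quotient.mk J (monomial s.1 1) := by
  simp [stdBasis]

/-- A polynomial supported on standard monomials is its own normal form, so its coordinates can be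
read off. -/
theorem stdBasis_repr_mk {S : Set (Fin n →₀ ℕ)} (hS : S = stdMons m J)
    {r : MvPolynomial (Fin n) K} (hr : ∀ s ∈ r.support, s ∈ S) (a : S) :
    (stdBasis hS).repr (Ideal.Quotient.mk J r) a = r.coeff a.1 := by
  classical
  have h : r = ∑ s ∈ r.support.attach, r.coeff s.1 • monomial s.1 (1 : K) := by
    conv_lhs => rw [r.as_sum]
    rw [← Finset.sum_attach]
    simp [smul_monomial]
  have h2 : Ideal.Quotient.mk J r =
      ∑ s ∈ r.support.attach, r.coeff s.1 • stdBasis hS ⟨s.1, hr _ s.2⟩ := by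
    conv_lhs => rw [h]
    simp only [stdBasis_apply, ← Ideal.Quotient.mkₐ_eq_mk K, map_sum, map_smul]
  rw [h2]
  simp only [map_sum, map_smul, Module.Basis.repr_self, Finsupp.coe_finsetSum, Finset.sum_apply,
    Finsupp.smul_single, smul_eq_mul, mul_one]
  by_cases ha : a.1 ∈ r.support
  · rw [Finset.sum_eq_single ⟨a.1, ha⟩]
    · simp
    · intro b _ hb
      rw [Finsupp.single_apply, if_neg]
      exact fun h => hb (Subtype.ext (congrArg (fun z : S => z.1) h))
    · simp
  · rw [notMem_support_iff.1 ha]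
    refine Finset.sum_eq_zero fun b _ => ?_
    rw [Finsupp.single_apply, if_neg]
    rintro rfl
    exact ha b.2

theorem finite_degree_eq (S : Set (Fin n →₀ ℕ)) (k : ℕ) :
    {s | s ∈ S ∧ s.degree = k}.Finite :=
  (Finsupp.finite_of_degree_le k).subset fun _ hs => hs.2.le

theorem finrank_homogeneous (m : MonomialOrder (Fin n))
    (hJ : J.IsHomogeneous (homogeneousSubmodule (Fin n) K)) (k : ℕ) :
    Module.finrank K ((homogeneousSubmodule (Fin n) K k).map (Ideal.Quotient.mkₐ K J).toLinearMap) =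
      {s | s ∈ stdMons m J ∧ s.degree = k}.ncard := by
  set S := {s | s ∈ stdMons m J ∧ s.degree = k} with hS
  have hli := linearIndependent_monomial (m := m) (J := J) (S := S) fun s hs => hs.1
  have := (finite_degree_eq (stdMons m J) k).fintype
  have hsp : (homogeneousSubmodule (Fin n) K k).map (Ideal.Quotient.mkₐ K J).toLinearMap =
      Submodule.span K
        (Set.range fun s : S => Ideal.Quotient.mk J (monomial s.1 (1 : K))) := by
    apply le_antisymm
    · rintro _ ⟨f, hf, rfl⟩
      obtain ⟨r, hr, hs⟩ := exists_normalForm m J f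
      -- The normal form `r` of `f` need not be homogeneous, but `J` is, so the component of `r` in
      -- degree `k` represents the same class.
      have h1 := homogeneousComponent_mem_of_mem hJ hr k
      rw [map_sub, homogeneousComponent_eq_self hf] at h1
      have h2 : Ideal.Quotient.mk J f = Ideal.Quotient.mk J (homogeneousComponent k r) :=
        Ideal.Quotient.eq.2 h1
      show Ideal.Quotient.mk J f ∈ _
      rw [h2]
      refine mk_mem_span_monomial fun s hs' => ?_
      rw [support_homogeneousComponent, Finset.mem_filter] at hs'
      exact ⟨hs s hs'.1, hs'.2⟩
    · rw [Submodule.span_le]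
      rintro _ ⟨s, rfl⟩
      exact ⟨_, isHomogeneous_monomial _ s.2.2, rfl⟩
  rw [hsp, finrank_span_eq_card hli, ← Nat.card_eq_fintype_card]
  rfl

end StandardMonomials

/-! ### The top ideal and the DRL ordering -/

section TopIdeal

variable {n : ℕ} {K : Type*} [Field K]

theorem topIdeal_isHomogeneous (I : Ideal (MvPolynomial (Fin n) K)) :
    (topIdeal I).IsHomogeneous (homogeneousSubmodule (Fin n) K) := by
  refine Ideal.homogeneous_span _ _ ?_
  rintro _ ⟨f, -, rfl⟩
  exact ⟨_, homogeneousComponent_mem _ _⟩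

theorem homogeneousComponent_succ_mul_X (k : ℕ) (f : MvPolynomial (Fin n) K) (i : Fin n) :
    homogeneousComponent (k + 1) (X i * f) = X i * homogeneousComponent k f := by
  classical
  ext s
  rw [coeff_homogeneousComponent, coeff_X_mul', coeff_X_mul']
  by_cases hi : i ∈ s.support
  · rw [if_pos hi, if_pos hi, coeff_homogeneousComponent]
    obtain ⟨t, rfl⟩ : ∃ t, s = Finsupp.single i 1 + t :=
      le_iff_exists_add.1 (Finsupp.single_le_iff.2
        (Nat.one_le_iff_ne_zero.2 (Finsupp.mem_support_iff.1 hi)))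
    rw [add_tsub_cancel_left, map_add, Finsupp.degree_single]
    congr 1
    rw [add_comm 1, Nat.add_right_cancel_iff]
  · simp [hi]

/-- The bound `totalDegree ≤ k`, rather than equality, makes the property stable under sums whose
top components cancel. Stability under multiplication is checked for constants, sums and variables,
with `k` shifting by one for a variable. -/
theorem exists_homogeneousComponent_eq {I : Ideal (MvPolynomial (Fin n) K)}
    {f : MvPolynomial (Fin n) K} (hf : f ∈ topIdeal I) :
    ∀ k, ∃ h ∈ I, h.totalDegree ≤ k ∧ homogeneousComponent k h = homogeneousComponent k f := by
  refine Submodule.span_induction ?_ ?_ ?_ ?_ hf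
  · rintro _ ⟨g, hg, rfl⟩ k
    rcases eq_or_ne k g.totalDegree with rfl | hk
    · exact ⟨g, hg, le_rfl, by
        rw [homogeneousComponent_of_mem (homogeneousComponent_mem _ _), if_pos rfl]⟩
    · exact ⟨0, I.zero_mem, by simp, by
        rw [homogeneousComponent_of_mem (homogeneousComponent_mem _ _), if_neg hk, map_zero]⟩
  · exact fun k => ⟨0, I.zero_mem, by simp, rfl⟩
  · intro f g _ _ hf hg k
    obtain ⟨a, ha, ha', ha''⟩ := hf k
    obtain ⟨b, hb, hb', hb''⟩ := hg k
    exact ⟨a + b, I.add_mem ha hb, (totalDegree_add a b).trans (max_le ha' hb'), by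
      rw [map_add, map_add, ha'', hb'']⟩
  · intro a f _ hf
    induction a using MvPolynomial.induction_on with
    | C c =>
      intro k
      obtain ⟨h, hh, hh', hh''⟩ := hf k
      refine ⟨C c * h, I.mul_mem_left _ hh, (totalDegree_mul _ _).trans (by simpa using hh'), ?_⟩
      rw [smul_eq_mul, homogeneousComponent_C_mul, homogeneousComponent_C_mul, hh'']
    | add p q hp hq =>
      intro k
      obtain ⟨a, ha, ha', ha''⟩ := hp k
      obtain ⟨b, hb, hb', hb''⟩ := hq k
      exact ⟨a + b, I.add_mem ha hb, (totalDegree_add a b).trans (max_le ha' hb'), by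
        rw [map_add, ha'', hb'', ← map_add, add_smul]⟩
    | mul_X p i hp =>
      intro k
      have he : (p * X i) • f = X i * (p • f) := by simp only [smul_eq_mul]; ring
      rw [he]
      cases k with
      | zero =>
        refine ⟨0, I.zero_mem, by simp, ?_⟩
        rw [map_zero, homogeneousComponent_zero, coeff_X_mul']
        simp
      | succ k =>
        obtain ⟨h, hh, hh', hh''⟩ := hp k
        refine ⟨X i * h, I.mul_mem_left _ hh, (totalDegree_mul _ _).trans ?_, ?_⟩
        · rw [totalDegree_X]; omega
        · rw [homogeneousComponent_succ_mul_X, homogeneousComponent_succ_mul_X, hh'']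

theorem drl_lt_of_degree_lt {a b : Fin n →₀ ℕ} (h : a.degree < b.degree) :
    (drl n).toSyn a < (drl n).toSyn b := by
  rw [drl_lt_iff]
  left
  simpa [Finsupp.degree_eq_sum] using h

theorem degree_le_degree_drl {f : MvPolynomial (Fin n) K} {s : Fin n →₀ ℕ} (hs : s ∈ f.support) :
    s.degree ≤ ((drl n).degree f).degree := by
  by_contra h
  exact ((drl n).le_degree hs).not_gt (drl_lt_of_degree_lt (not_le.1 h))

theorem degree_degree_drl {f : MvPolynomial (Fin n) K} (hf : f ≠ 0) :
    ((drl n).degree f).degree = f.totalDegree := by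
  apply le_antisymm
  · exact le_totalDegree ((drl n).degree_mem_support hf)
  · exact Finset.sup_le fun s hs => degree_le_degree_drl hs

theorem drl_degree_homogeneousComponent {f : MvPolynomial (Fin n) K} (hf : f ≠ 0) :
    homogeneousComponent f.totalDegree f ≠ 0 ∧
      (drl n).degree (homogeneousComponent f.totalDegree f) = (drl n).degree f := by
  have h1 : (drl n).degree f ∈ (homogeneousComponent f.totalDegree f).support := by
    rw [support_homogeneousComponent, Finset.mem_filter]
    exact ⟨(drl n).degree_mem_support hf, degree_degree_drl hf⟩
  refine ⟨fun h => by simp [h] at h1, (drl n).toSyn.injective (le_antisymm ?_ ?_)⟩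
  · refine (drl n).degree_le_iff.2 fun s hs => ?_
    rw [support_homogeneousComponent, Finset.mem_filter] at hs
    exact (drl n).le_degree hs.1
  · exact (drl n).le_degree h1

/-- DRL refines the degree, so a nonzero polynomial and its top component share their leading
monomial; conversely each nonzero top component of an element of the top ideal is already that of an
element of `I`. -/
theorem stdMons_topIdeal (I : Ideal (MvPolynomial (Fin n) K)) :
    stdMons (drl n) (topIdeal I) = stdMons (drl n) I := by
  ext s
  constructor
  · rintro hs f hf hf0 rfl
    exact hs _ (Ideal.subset_span ⟨f, hf, rfl⟩) (drl_degree_homogeneousComponent hf0).1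
      (drl_degree_homogeneousComponent hf0).2
  · rintro hs f hf hf0 rfl
    obtain ⟨h, hI, hdeg, hh⟩ := exists_homogeneousComponent_eq hf f.totalDegree
    obtain ⟨h1, h2⟩ := drl_degree_homogeneousComponent hf0
    have h0 : h ≠ 0 := by
      rintro rfl
      rw [map_zero] at hh
      exact h1 hh.symm
    have hd : h.totalDegree = f.totalDegree := by
      refine le_antisymm hdeg (not_lt.1 fun hlt => h1 ?_)
      rw [← hh, homogeneousComponent_eq_zero _ _ hlt]
    refine hs h hI h0 ?_
    rw [← (drl_degree_homogeneousComponent h0).2, hd, hh, h2]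

theorem drl_lt_of_lastVar_lt [NeZero n] {a b : Fin n →₀ ℕ} (hd : a.degree = b.degree)
    (h : b (lastVar n) < a (lastVar n)) : (drl n).toSyn a < (drl n).toSyn b := by
  rw [drl_lt_iff]
  refine Or.inr ⟨by simpa [Finsupp.degree_eq_sum] using hd, lastVar n, fun j hj => ?_, h⟩
  have h1 : n - 1 < j.1 := hj
  omega

/-- Let `f = j + q` with `j ∈ J` and `q` a multiple of `x_n^e`. If the leading monomial of `f` has
`x_n`-exponent below `e`, it is also that of the component of `j` in the same degree: monomials of
this component with exponent below `e` occur in `f`, and the others are smaller in DRL. -/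
theorem stdMons_sup_span_X_pow [NeZero n] {J : Ideal (MvPolynomial (Fin n) K)}
    (hJ : J.IsHomogeneous (homogeneousSubmodule (Fin n) K)) (e : ℕ) :
    stdMons (drl n) (J ⊔ Ideal.span {(X (lastVar n) : MvPolynomial (Fin n) K) ^ e}) =
      {s | s ∈ stdMons (drl n) J ∧ s (lastVar n) < e} := by
  ext s
  constructor
  · intro hs
    refine ⟨stdMons_anti le_sup_left hs, not_le.1 fun he => monomial_notMem_of_mem_stdMons hs ?_⟩
    refine Ideal.mem_sup_right (Ideal.mem_span_singleton.2 ?_)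
    rw [X_pow_eq_monomial, monomial_dvd_monomial]
    exact ⟨Or.inr (Finsupp.single_le_iff.2 he), one_dvd _⟩
  · rintro ⟨hs, he⟩ f hf hf0 rfl
    obtain ⟨j, hj, q, hq, hjq⟩ := Submodule.mem_sup.1 hf
    have hc : ∀ t : Fin n →₀ ℕ, t (lastVar n) < e → coeff t f = coeff t j := by
      intro t ht
      obtain ⟨q, rfl⟩ := Ideal.mem_span_singleton.1 hq
      rw [← hjq, coeff_add, X_pow_eq_monomial, coeff_monomial_mul', if_neg, add_zero]
      rw [Finsupp.single_le_iff]
      exact not_le.2 ht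
    obtain ⟨D, hD⟩ : ∃ D, D = ((drl n).degree f).degree := ⟨_, rfl⟩
    obtain ⟨g, hg⟩ : ∃ g, g = homogeneousComponent D j := ⟨_, rfl⟩
    have hsupp : ∀ t, t ∈ g.support ↔ t ∈ j.support ∧ t.degree = D := by
      intro t
      rw [hg, support_homogeneousComponent, Finset.mem_filter]
    have hmem : (drl n).degree f ∈ g.support := by
      rw [hsupp, mem_support_iff, ← hc _ he]
      exact ⟨mem_support_iff.1 ((drl n).degree_mem_support hf0), hD.symm⟩
    have hle : ∀ t ∈ g.support, (drl n).toSyn t ≤ (drl n).toSyn ((drl n).degree f) := by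
      intro t ht
      rw [hsupp] at ht
      rcases lt_or_ge (t (lastVar n)) e with h | h
      · refine (drl n).le_degree (mem_support_iff.2 ?_)
        rw [hc t h]
        exact mem_support_iff.1 ht.1
      · exact (drl_lt_of_lastVar_lt (ht.2.trans hD) (he.trans_le h)).le
    have hgJ : g ∈ J := hg ▸ homogeneousComponent_mem_of_mem hJ hj D
    exact hs g hgJ (fun h => by simp [h] at hmem)
      ((drl n).toSyn.injective (le_antisymm ((drl n).degree_le_iff.2 hle) ((drl n).le_degree hmem)))

end TopIdeal

/-! ### From Hilbert series to minimality of `x_n b` -/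

section StrongLefschetz

variable {n : ℕ} {K : Type*} [Field K] [NeZero n]

/-- `HQ_e = [(1 - t^e) H]_+`, read on the standard monomials: if the multiplication by `x_n^e`
sends some standard monomial of degree `k` out of the staircase, then every standard monomial of
degree `k + e` is divisible by `x_n^e`. -/
theorem le_lastVar_of_froberg {I : Ideal (MvPolynomial (Fin n) K)} {e : ℕ}
    (hI : hilbertSeries (topIdeal I ⊔ Ideal.span {(X (lastVar n) : MvPolynomial (Fin n) K) ^ e}) =
      truncPos ((1 - PowerSeries.X ^ e) * hilbertSeries (topIdeal I)))
    {b c : Fin n →₀ ℕ} (hb : b ∈ stdMons (drl n) I)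
    (hbe : b + Finsupp.single (lastVar n) e ∉ stdMons (drl n) I)
    (hc : c ∈ stdMons (drl n) I) (hbc : c.degree = b.degree + e) : e ≤ c (lastVar n) := by
  have hJ := topIdeal_isHomogeneous I
  have hJ' : (topIdeal I ⊔ Ideal.span {(X (lastVar n) : MvPolynomial (Fin n) K) ^ e}).IsHomogeneous
      (homogeneousSubmodule (Fin n) K) := by
    refine hJ.sup (Ideal.homogeneous_span _ _ ?_)
    rintro _ rfl
    exact ⟨e, isHomogeneous_X_pow _ _⟩
  have h := congrArg (PowerSeries.coeff (b.degree + e)) hI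
  rw [hilbertSeries, PowerSeries.coeff_mk, finrank_homogeneous (drl n) hJ',
    stdMons_sup_span_X_pow hJ, stdMons_topIdeal, truncPos, PowerSeries.coeff_mk] at h
  rw [sub_mul, one_mul, map_sub (PowerSeries.coeff (b.degree + e)), PowerSeries.coeff_X_pow_mul,
    hilbertSeries, PowerSeries.coeff_mk, PowerSeries.coeff_mk, finrank_homogeneous (drl n) hJ,
    finrank_homogeneous (drl n) hJ, stdMons_topIdeal] at h
  set E := stdMons (drl n) I with hE
  set A := {s | s ∈ E ∧ s.degree = b.degree + e} with hA
  set L := {s | s ∈ {s | s ∈ E ∧ s (lastVar n) < e} ∧ s.degree = b.degree + e} with hL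
  have hAfin : A.Finite := finite_degree_eq _ _
  have hLA : L ⊆ A := fun s hs => ⟨hs.1.1, hs.2⟩
  by_contra! hlt
  have hcL : c ∈ L := ⟨⟨hc, hlt⟩, hbc⟩
  have hpos : 0 < L.ncard := (Set.ncard_pos (hAfin.subset hLA)).2 ⟨c, hcL⟩
  -- If the truncation has not started, `h` equates the size of `L` with that of `A` minus that of
  -- the slice of `E` in the degree of `b`; otherwise it says that `L` is empty, against `c ∈ L`.
  split_ifs at h with h0
  -- Division by `x_n^e` injects `A \ L` into the slice of `E` in the degree of `b`, and misses `b`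
  -- itself. So `L` has more elements than the untruncated coefficient allows.
  · have hcard : (A \ L).ncard < {s | s ∈ E ∧ s.degree = b.degree}.ncard := by
      have hge : ∀ s ∈ A \ L, Finsupp.single (lastVar n) e ≤ s := by
        intro s hs
        rw [Finsupp.single_le_iff]
        by_contra! hs'
        exact hs.2 ⟨⟨hs.1.1, hs'⟩, hs.1.2⟩
      rw [← Set.InjOn.ncard_image (f := fun s => s - Finsupp.single (lastVar n) e)]
      · refine Set.ncard_lt_ncard ⟨?_, fun hsub => ?_⟩ (finite_degree_eq _ _)
        · rintro _ ⟨s, hs, rfl⟩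
          refine ⟨mem_stdMons_of_le tsub_le_self hs.1.1, ?_⟩
          have h1 := congrArg Finsupp.degree (tsub_add_cancel_of_le (hge s hs))
          rw [map_add, Finsupp.degree_single, hs.1.2] at h1
          exact Nat.add_right_cancel h1
        · obtain ⟨s, hs, hsb⟩ := hsub ⟨hb, rfl⟩
          apply hbe
          rw [← hsb]
          dsimp only
          rw [tsub_add_cancel_of_le (hge s hs)]
          exact hs.1.1
      · intro s hs t ht hst
        dsimp only at hst
        rw [← tsub_add_cancel_of_le (hge s hs), hst, tsub_add_cancel_of_le (hge t ht)]
    have hsum := Set.ncard_sdiff_add_ncard_of_subset hLA hAfin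
    omega
  · omega

/-- A proper divisor `u` of `x_n b` outside `E` cannot divide `b`, so it divides `x_n b / x_i` for
some `i ≠ n` with `x_i` dividing `b`. Write `b = x_i x_n^r t`, with `r` the full exponent of `x_n`
in `b`. Then `t ∈ E` but `x_n^{r+1} t ∉ E`, so every standard monomial of the degree of `x_n^{r+1}
t` is divisible by `x_n^{r+1}`. But `b` has that degree. -/
theorem mem_or_isMinimal {I : Ideal (MvPolynomial (Fin n) K)}
    (hI : ∀ e : ℕ, 1 ≤ e →
      hilbertSeries (topIdeal I ⊔ Ideal.span {(X (lastVar n) : MvPolynomial (Fin n) K) ^ e}) =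
        truncPos ((1 - PowerSeries.X ^ e) * hilbertSeries (topIdeal I)))
    {b u : Fin n →₀ ℕ} (hb : b ∈ stdMons (drl n) I) (hu : u ∉ stdMons (drl n) I)
    (hub : u ≤ b + Finsupp.single (lastVar n) 1) : u = b + Finsupp.single (lastVar n) 1 := by
  by_contra hne
  obtain ⟨i, hi⟩ : ∃ i, u i < (b + Finsupp.single (lastVar n) 1 : Fin n →₀ ℕ) i := by
    by_contra! hle
    exact hne (le_antisymm hub hle)
  rcases eq_or_ne i (lastVar n) with rfl | hin
  · refine hu (mem_stdMons_of_le (fun j => ?_) hb)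
    rcases eq_or_ne j (lastVar n) with rfl | hj
    · simpa [Nat.lt_succ_iff] using hi
    · simpa [hj.symm] using hub j
  · have hbi : u i < b i := by simpa [hin.symm] using hi
    obtain ⟨r, hr⟩ : ∃ r, r = b (lastVar n) := ⟨_, rfl⟩
    have h1 : Finsupp.single i 1 + Finsupp.single (lastVar n) r ≤ b := by
      intro j
      rcases eq_or_ne j i with rfl | hj
      · simp [hin]; omega
      · rcases eq_or_ne j (lastVar n) with rfl | hj'
        · simp [hin, hr]
        · simp [hj, hj']
    obtain ⟨t, ht⟩ := le_iff_exists_add.1 h1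
    have htS : t ∈ stdMons (drl n) I := mem_stdMons_of_le (ht ▸ le_add_self) hb
    have htn : t + Finsupp.single (lastVar n) (r + 1) ∉ stdMons (drl n) I := by
      refine fun hmem => hu (mem_stdMons_of_le (fun j => ?_) hmem)
      have hj := hub j
      rw [ht] at hj hbi
      rcases eq_or_ne j i with rfl | hji
      · simp [hin] at hbi ⊢; omega
      · rcases eq_or_ne j (lastVar n) with rfl | hj'
        · simp [hin.symm] at hj ⊢; omega
        · simpa [hji.symm, hj'.symm, hji, hj'] using hj
    -- Replacing the factor `x_i` of `b` by one more `x_n` preserves the degree.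
    have hle := le_lastVar_of_froberg (hI (r + 1) (by omega)) htS htn hb (by
      conv_lhs => rw [ht]
      simp only [map_add, Finsupp.degree_single]
      omega)
    omega

end StrongLefschetz

/-! ### The two kinds of columns -/

section Columns

variable {n : ℕ} {K : Type*} [Field K] [NeZero n] {m : MonomialOrder (Fin n)}
  {I : Ideal (MvPolynomial (Fin n) K)} {S : Set (Fin n →₀ ℕ)} (hS : S = stdMons m I)

theorem multMatrix_stdBasis (a b : S) :
    multMatrix (stdBasis hS) a b = (stdBasis hS).repr
      (Ideal.Quotient.mk I (monomial (b.1 + Finsupp.single (lastVar n) 1) 1)) a := by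
  rw [multMatrix, Matrix.of_apply, stdBasis_apply, ← map_mul, X, monomial_mul, one_mul, add_comm]

theorem multMatrix_of_mem (a b c : S) (hc : c.1 = b.1 + Finsupp.single (lastVar n) 1) :
    multMatrix (stdBasis hS) a b = if a = c then 1 else 0 := by
  classical
  rw [multMatrix_stdBasis, ← hc, ← stdBasis_apply hS, Module.Basis.repr_self,
    Finsupp.single_apply]
  exact if_congr eq_comm rfl rfl

/-- Modulo `I`, the leading monomial of `g` equals minus the tail of `g`. That tail is in normal
form: other leading monomials do not divide its terms because the basis is reduced, and that of `g`
does not because its terms are smaller. -/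
theorem multMatrix_of_degree_eq {G : Set (MvPolynomial (Fin n) K)}
    (hG : IsReducedGroebnerBasis m G I) (hS' : S = staircase m G)
    {g : MvPolynomial (Fin n) K} (hg : g ∈ G) (a b : S)
    (hgb : m.degree g = b.1 + Finsupp.single (lastVar n) 1) :
    multMatrix (stdBasis hS) a b = - g.coeff a.1 := by
  classical
  have hlc : g.coeff (m.degree g) = 1 := hG.2.1 g hg
  have hne : m.degree g ≠ a.1 := by
    intro h
    exact hS'.le a.2 g hg h.le
  have hmk : Ideal.Quotient.mk I (monomial (b.1 + Finsupp.single (lastVar n) 1) 1) =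
      Ideal.Quotient.mk I (monomial (m.degree g) 1 - g) := by
    rw [← hgb, map_sub, Ideal.Quotient.eq_zero_iff_mem.2 (hG.1.2.1 hg), sub_zero]
  rw [multMatrix_stdBasis, hmk, stdBasis_repr_mk, coeff_sub, coeff_monomial, if_neg hne, zero_sub]
  intro s hs
  rw [mem_support_iff, coeff_sub, coeff_monomial] at hs
  have hsg : m.degree g ≠ s := by
    rintro rfl
    simp [hlc] at hs
  rw [if_neg hsg, zero_sub, neg_ne_zero] at hs
  rw [hS']
  intro g' hg' hle
  rcases eq_or_ne g' g with rfl | hgg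
  · exact hsg (m.toSyn.injective (le_antisymm (m.toSyn_monotone hle)
      (m.le_degree (mem_support_iff.2 hs))))
  · exact hG.2.2 g hg g' hg' hgg s (mem_support_iff.2 hs) hle

end Columns

/-! ### The algorithm on lists of exponents, and its computability -/

section PrimrecLists

/-- The lists of length `k` with entries less than `N`. -/
def boxLists (N k : ℕ) : List (List ℕ) :=
  Nat.rec [[]] (fun _ L => (List.range N).flatMap fun x => L.map (x :: ·)) k

theorem mem_boxLists {N k : ℕ} {l : List ℕ} :
    l ∈ boxLists N k ↔ l.length = k ∧ ∀ x ∈ l, x < N := by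
  induction k generalizing l with
  | zero =>
    show l ∈ [[]] ↔ _
    rw [List.mem_singleton, List.length_eq_zero_iff]
    exact ⟨fun h => ⟨h, by simp [h]⟩, fun h => h.1⟩
  | succ k ih =>
    show l ∈ (List.range N).flatMap (fun x => (boxLists N k).map (x :: ·)) ↔ _
    simp only [List.mem_flatMap, List.mem_range, List.mem_map, ih]
    constructor
    · rintro ⟨x, hx, t, ⟨rfl, ht⟩, rfl⟩
      exact ⟨rfl, by simpa using ⟨hx, ht⟩⟩
    · rintro ⟨hl, h⟩
      cases l with
      | nil => simp at hl
      | cons x t =>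
        simp only [List.mem_cons, forall_eq_or_imp] at h
        exact ⟨x, h.1, t, ⟨by simpa using hl, h.2⟩, rfl⟩

theorem nodup_boxLists (N k : ℕ) : (boxLists N k).Nodup := by
  induction k with
  | zero => exact List.nodup_singleton _
  | succ k ih =>
    show ((List.range N).flatMap fun x => (boxLists N k).map (x :: ·)).Nodup
    rw [List.nodup_flatMap]
    refine ⟨fun x _ => ih.map fun _ _ h => (List.cons.inj h).2, ?_⟩
    refine List.Pairwise.imp ?_ List.nodup_range
    intro x y hxy l hx hy
    simp only [List.mem_map] at hx hy
    obtain ⟨s, -, rfl⟩ := hx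
    obtain ⟨t, -, h⟩ := hy
    exact hxy (List.cons.inj h).1.symm

theorem primrec_boxLists : Primrec₂ boxLists := by
  refine Primrec.nat_rec (f := fun _ : ℕ => [[]])
    (g := fun N p => (List.range N).flatMap fun x => p.2.map (x :: ·)) (Primrec.const _) ?_
  refine Primrec.list_flatMap (Primrec.list_range.comp Primrec.fst) ?_
  refine Primrec.list_map (Primrec.snd.comp (Primrec.snd.comp Primrec.fst)) ?_
  exact Primrec.list_cons.comp (Primrec.snd.comp Primrec.fst) Primrec.snd

/-- Divisibility of monomials, on lists of exponents. -/
def ListDvd (u v : List ℕ) : Prop :=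
  ∀ i ∈ List.range u.length, u.getD i 0 ≤ v.getD i 0

instance : DecidableRel ListDvd := fun u v =>
  inferInstanceAs (Decidable (∀ i ∈ List.range u.length, u.getD i 0 ≤ v.getD i 0))

theorem primrecRel_listDvd : PrimrecRel ListDvd := by
  have h : PrimrecRel fun (i : ℕ) (p : List ℕ × List ℕ) => p.1.getD i 0 ≤ p.2.getD i 0 :=
    Primrec.nat_le.comp
      ((Primrec.list_getD 0).comp (Primrec.fst.comp Primrec.snd) Primrec.fst)
      ((Primrec.list_getD 0).comp (Primrec.snd.comp Primrec.snd) Primrec.fst)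
  exact h.forall_mem_list.comp
    (Primrec.list_range.comp (Primrec.list_length.comp Primrec.fst)) Primrec.id

/-- The leading monomials of monomial data. -/
def headMons (D : MonData) : List (List ℕ) := D.2.map List.headI

theorem primrec_headMons : Primrec headMons :=
  Primrec.list_map Primrec.snd (Primrec.list_headI.comp Primrec.snd)

/-- The multiplication of a monomial by the last variable, on lists of exponents. -/
def incrLast (l : List ℕ) : List ℕ := l.modify (l.length - 1) Nat.succ

theorem primrec_incrLast : Primrec incrLast :=
  (Primrec.list_modify Primrec.succ).comp Primrec.id
    (Primrec.nat_sub.comp Primrec.list_length (Primrec.const 1))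

/-- The standard monomials, found among the monomials whose exponents are less than the sum of the
exponents of the leading monomials. -/
def stdIndex (D : MonData) : List (List ℕ) :=
  (boxLists (headMons D).flatten.sum D.1).filter fun s => ∀ u ∈ headMons D, ¬ ListDvd u s

theorem primrec_stdIndex : Primrec stdIndex := by
  have h : PrimrecRel fun (s : List ℕ) (L : List (List ℕ)) => ∀ u ∈ L, ¬ ListDvd u s :=
    ((primrecRel_listDvd.not).forall_mem_list).comp Primrec.snd Primrec.fst
  refine h.listFilter.comp (primrec_boxLists.comp ?_ Primrec.fst) primrec_headMons
  exact Primrec.list_foldr (Primrec.list_flatten.comp primrec_headMons) (Primrec.const 0)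
    (Primrec.nat_add.comp (Primrec.fst.comp Primrec.snd) (Primrec.snd.comp Primrec.snd)).to₂

theorem primrec_input : Primrec₂ Instr.input := by
  have h : Primrec fun p : ℕ × ℕ =>
      instrEquiv.symm (Sum.inr ((0 : Fin 5), p) : (Bool ⊕ ℕ) ⊕ (Fin 5 × ℕ × ℕ)) :=
    (Primrec.of_equiv_symm (e := instrEquiv)).comp
      (Primrec.sumInr.comp (Primrec.pair (Primrec.const 0) Primrec.id))
  exact h

theorem primrec_idxOf : Primrec₂ fun (a : List ℕ) (L : List (List ℕ)) => L.idxOf a := by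
  convert Primrec.list_idxOf (α := List ℕ) using 4

/-- The straight-line program that copies the entry of row `a` and column `b` of the matrix of the
multiplication by the last variable. -/
def copyEntry (x : MonData × List ℕ × List ℕ) : List Instr :=
  -- `idxOf` returns the length for an absent element, so both comparisons with a length test
  -- membership.
  if (headMons x.1).idxOf (incrLast x.2.2) < x.1.2.length then
    if (x.1.2.getI ((headMons x.1).idxOf (incrLast x.2.2))).idxOf x.2.1 <
        (x.1.2.getI ((headMons x.1).idxOf (incrLast x.2.2))).length then
      -- The coefficient is copied into register 0, and `neg 0` writes its opposite as the output.
      [Instr.input ((headMons x.1).idxOf (incrLast x.2.2))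
        ((x.1.2.getI ((headMons x.1).idxOf (incrLast x.2.2))).idxOf x.2.1), Instr.neg 0]
    else [Instr.zero]
  else if x.2.1 = incrLast x.2.2 then [Instr.one] else [Instr.zero]

theorem primrec_copyEntry : Primrec copyEntry := by
  have hb : Primrec fun x : MonData × List ℕ × List ℕ => incrLast x.2.2 :=
    primrec_incrLast.comp (Primrec.snd.comp Primrec.snd)
  have hi : Primrec fun x : MonData × List ℕ × List ℕ =>
      (headMons x.1).idxOf (incrLast x.2.2) :=
    primrec_idxOf.comp hb (primrec_headMons.comp Primrec.fst)
  have hl : Primrec fun x : MonData × List ℕ × List ℕ =>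
      x.1.2.getI ((headMons x.1).idxOf (incrLast x.2.2)) :=
    Primrec.list_getI.comp (Primrec.snd.comp Primrec.fst) hi
  have ha : Primrec fun x : MonData × List ℕ × List ℕ => x.2.1 := Primrec.fst.comp Primrec.snd
  have hj := primrec_idxOf.comp ha hl
  refine Primrec.ite (Primrec.nat_lt.comp hi
    (Primrec.list_length.comp (Primrec.snd.comp Primrec.fst))) ?_ ?_
  · refine Primrec.ite (Primrec.nat_lt.comp hj (Primrec.list_length.comp hl)) ?_ (Primrec.const _)
    exact Primrec.list_cons.comp (primrec_input.comp hi hj) (Primrec.const _)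
  · exact Primrec.ite (Primrec.eq.comp ha hb) (Primrec.const _) (Primrec.const _)

theorem progCost_copyEntry (x : MonData × List ℕ × List ℕ) : progCost (copyEntry x) = 0 := by
  unfold copyEntry
  split_ifs <;> rfl

/-- The algorithm that reads the matrix of the multiplication by the last variable on a Gröbner
basis. -/
def copyAlgorithm : MatrixAlgorithm where
  index := stdIndex
  entry := copyEntry
  index_computable := primrec_stdIndex.to_comp
  entry_computable := primrec_copyEntry.to_comp

theorem arithOps_copyAlgorithm (D : MonData) : copyAlgorithm.arithOps D = 0 := by
  simp [MatrixAlgorithm.arithOps, copyAlgorithm, progCost_copyEntry]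

end PrimrecLists

/-! ### Monomials versus exponent lists -/

section MonomialLists

variable {n : ℕ} {K : Type*} [Field K]

theorem expList_injective : Function.Injective (expList (n := n)) := fun _ _ h =>
  Finsupp.ext (congrFun (List.ofFn_injective h))

theorem length_expList (a : Fin n →₀ ℕ) : (expList a).length = n := List.length_ofFn

theorem getD_expList (a : Fin n →₀ ℕ) (i : Fin n) : (expList a).getD i 0 = a i := by
  rw [List.getD_eq_getElem _ _ (by rw [length_expList]; exact i.2)]
  simp [expList]

theorem exists_expList_eq {l : List ℕ} (hl : l.length = n) :
    ∃ a : Fin n →₀ ℕ, l = expList a := by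
  subst hl
  exact ⟨Finsupp.equivFunOnFinite.symm l.get, by simp [expList]⟩

theorem listDvd_expList {a b : Fin n →₀ ℕ} : ListDvd (expList a) (expList b) ↔ a ≤ b := by
  constructor
  · intro h i
    have := h i (by rw [List.mem_range, length_expList]; exact i.2)
    rwa [getD_expList, getD_expList] at this
  · intro h i hi
    rw [List.mem_range, length_expList] at hi
    have := h ⟨i, hi⟩
    rwa [← getD_expList, ← getD_expList] at this

theorem incrLast_expList [NeZero n] (b : Fin n →₀ ℕ) :
    incrLast (expList b) = expList (b + Finsupp.single (lastVar n) 1) := by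
  refine List.ext_getElem (by simp [incrLast, length_expList]) fun i h1 h2 => ?_
  rw [length_expList] at h2
  simp only [incrLast, List.getElem_modify, length_expList]
  simp only [expList, List.getElem_ofFn, Finsupp.add_apply, Finsupp.single_apply, lastVar,
    Fin.mk.injEq]
  split_ifs <;> simp

theorem mem_monList {g : MvPolynomial (Fin n) K} {s : Fin n →₀ ℕ} :
    s ∈ monList g ↔ s ∈ g.support := by
  simp only [monList, List.mem_map, Finset.mem_sort, Finset.mem_map]
  constructor
  · rintro ⟨_, ⟨t, ht, rfl⟩, rfl⟩
    simpa using ht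
  · intro h
    exact ⟨_, ⟨s, h, rfl⟩, by simp⟩

theorem headI_map_monList {g : MvPolynomial (Fin n) K} (hg : g ≠ 0) :
    ((monList g).map expList).headI = expList ((drl n).degree g) := by
  have hd : (drl n).degree g ∈ monList g := mem_monList.2 ((drl n).degree_mem_support hg)
  have hs : (monList g).Pairwise fun s t => (drl n).toSyn t ≤ (drl n).toSyn s := by
    rw [monList, List.pairwise_map]
    refine (Finset.pairwise_sort _ (· ≥ ·)).imp fun h => ?_
    simpa using h
  cases hl : monList g with
  | nil => simp [hl] at hd
  | cons x t =>
    rw [hl] at hd hs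
    rw [List.pairwise_cons] at hs
    have hx : x ∈ g.support := mem_monList.1 (by simp [hl])
    have h : x = (drl n).degree g := by
      refine (drl n).toSyn.injective (le_antisymm ((drl n).le_degree hx) ?_)
      rcases List.mem_cons.1 hd with h | h
      · rw [h]
      · exact hs.1 _ h
    simp [h]

theorem headMons_monData {G : List (MvPolynomial (Fin n) K)} (hG : ∀ g ∈ G, g ≠ 0) :
    headMons (monData G) = G.map fun g => expList ((drl n).degree g) := by
  simp only [headMons, monData, List.map_map]
  exact List.map_congr_left fun g hg => headI_map_monList (hG g hg)

end MonomialLists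

/-! ### Correctness of the algorithm -/

section Correctness

variable {n : ℕ} {K : Type*} [Field K] {G : List (MvPolynomial (Fin n) K)}

/-- A finite staircase omits some power of `x_i`, so a leading monomial is a power of `x_i`. The
exponent of `x_i` in a standard monomial is smaller than the exponent of that power, which is one
summand of the bound. -/
theorem apply_lt_sum_headMons (hG : ∀ g ∈ G, g ≠ 0)
    (hfin : (staircase (drl n) {g | g ∈ G}).Finite) {a : Fin n →₀ ℕ}
    (ha : a ∈ staircase (drl n) {g | g ∈ G}) (i : Fin n) :
    a i < (headMons (monData G)).flatten.sum := by
  obtain ⟨k, hk⟩ : ∃ k, Finsupp.single i k ∉ staircase (drl n) {g | g ∈ G} := by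
    by_contra! h
    exact Set.infinite_of_injective_forall_mem (Finsupp.single_injective i) h hfin
  simp only [staircase, Set.mem_ofPred_eq, not_forall, not_not] at hk
  obtain ⟨g, hg, hle⟩ := hk
  have hlt : a i < (drl n).degree g i := by
    by_contra! h
    refine ha g hg fun j => ?_
    rcases eq_or_ne j i with rfl | hj
    · exact h
    · have := hle j
      rw [Finsupp.single_eq_of_ne hj] at this
      exact this.trans (Nat.zero_le _)
  refine hlt.trans_le (List.single_le_sum (by simp) _ ?_)
  rw [headMons_monData hG, List.mem_flatten]
  exact ⟨_, List.mem_map.2 ⟨g, hg, rfl⟩, (List.mem_ofFn' _ _).2 ⟨i, rfl⟩⟩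

theorem mem_stdIndex (hG : ∀ g ∈ G, g ≠ 0)
    (hfin : (staircase (drl n) {g | g ∈ G}).Finite) (l : List ℕ) :
    l ∈ stdIndex (monData G) ↔ ∃ a ∈ staircase (drl n) {g | g ∈ G}, l = expList a := by
  have hstd : ∀ a : Fin n →₀ ℕ, (∀ u ∈ headMons (monData G), ¬ ListDvd u (expList a)) ↔
      a ∈ staircase (drl n) {g | g ∈ G} := by
    intro a
    rw [headMons_monData hG]
    simp only [List.forall_mem_map, listDvd_expList]
    rfl
  rw [stdIndex, List.mem_filter, decide_eq_true_iff, mem_boxLists]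
  constructor
  · rintro ⟨⟨hl, -⟩, h⟩
    obtain ⟨a, rfl⟩ := exists_expList_eq (n := n) hl
    exact ⟨a, (hstd a).1 h, rfl⟩
  · rintro ⟨a, ha, rfl⟩
    refine ⟨⟨length_expList a, fun x hx => ?_⟩, (hstd a).2 ha⟩
    obtain ⟨i, rfl⟩ := (List.mem_ofFn' _ _).1 hx
    exact apply_lt_sum_headMons hG hfin ha i

theorem progOutput_input_neg (c : ℕ → ℕ → Option K) {i j : ℕ} {x : K} (h : c i j = some x) :
    progOutput c [Instr.input i j, Instr.neg 0] = some (-x) := by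
  simp [progOutput, progRun, Instr.exec, h]

theorem progOutput_zero (c : ℕ → ℕ → Option K) : progOutput c [Instr.zero] = some 0 := by
  simp [progOutput, progRun, Instr.exec]

theorem progOutput_one (c : ℕ → ℕ → Option K) : progOutput c [Instr.one] = some 1 := by
  simp [progOutput, progRun, Instr.exec]

/-- `hz2` covers every `g` with leading monomial `x_n b`, so it applies to whichever one the search
finds. -/
theorem progOutput_copyEntry [NeZero n] (hG : ∀ g ∈ G, g ≠ 0) (a b : Fin n →₀ ℕ) (z : K)
    (hz1 : (∀ g ∈ G, (drl n).degree g ≠ b + Finsupp.single (lastVar n) 1) →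
      z = if a = b + Finsupp.single (lastVar n) 1 then 1 else 0)
    (hz2 : ∀ g ∈ G, (drl n).degree g = b + Finsupp.single (lastVar n) 1 → z = - g.coeff a) :
    progOutput (coeffData G) (copyEntry (monData G, expList a, expList b)) = some z := by
  unfold copyEntry
  dsimp only
  rw [incrLast_expList]
  obtain ⟨i, hi⟩ : ∃ i, i = (headMons (monData G)).idxOf
      (expList (b + Finsupp.single (lastVar n) 1)) := ⟨_, rfl⟩
  rw [← hi]
  have hlen : (monData G).2.length = G.length := by simp [monData]
  have hlen' : (headMons (monData G)).length = G.length := by simp [headMons, monData]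
  rw [hlen]
  have hdata : ∀ h1 : i < G.length, (monData G).2.getI i = (monList G[i]).map expList ∧
      (drl n).degree G[i] = b + Finsupp.single (lastVar n) 1 := by
    intro h1
    constructor
    · rw [List.getI_eq_getElem _ (by rw [hlen]; exact h1)]
      simp [monData]
    · have h := List.getElem_idxOf (hi ▸ hlen'.symm ▸ h1)
      rw [headMons_monData hG] at hi
      simp only [headMons_monData hG, List.getElem_map] at h
      simp only [← hi] at h
      exact expList_injective h
  split_ifs with h1 h2 h3
  · have hg := List.getElem_mem h1
    obtain ⟨hrow, hdeg⟩ := hdata h1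
    rw [hz2 _ hg hdeg]
    apply progOutput_input_neg
    rw [hrow] at h2 ⊢
    obtain ⟨j, hj⟩ : ∃ j, j = ((monList G[i]).map expList).idxOf (expList a) := ⟨_, rfl⟩
    have h := List.getElem_idxOf h2
    simp only [← hj] at h h2 ⊢
    rw [List.length_map] at h2
    rw [List.getElem_map] at h
    simp [coeffData, h1, h2, expList_injective h]
  · have hg := List.getElem_mem h1
    obtain ⟨hrow, hdeg⟩ := hdata h1
    have ha : coeff a G[i] = 0 := by
      rw [hrow, List.idxOf_lt_length_iff] at h2
      refine notMem_support_iff.1 fun ha => h2 ?_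
      exact List.mem_map.2 ⟨a, mem_monList.2 ha, rfl⟩
    -- A monomial absent from the list of `g` has coefficient 0, so the constant program is correct.
    rw [hz2 _ hg hdeg, ha, neg_zero]
    exact progOutput_zero _
  all_goals
    have hno : ∀ g ∈ G, (drl n).degree g ≠ b + Finsupp.single (lastVar n) 1 := by
      intro g hg hgb
      rw [hi, ← hlen', List.idxOf_lt_length_iff, headMons_monData hG, List.mem_map] at h1
      exact h1 ⟨g, hg, by rw [hgb]⟩
    rw [hz1 hno]
  · rw [if_pos (expList_injective h3)]
    exact progOutput_one _
  · rw [if_neg fun h => h3 (congrArg expList h)]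
    exact progOutput_zero _

end Correctness

end DetIdeal

theorem theorem1 :
    ∃ A : MatrixAlgorithm,
      ∀ (K : Type*) [Field K] [Infinite K] (n p d : ℕ) [NeZero n]
        (_hp : 1 ≤ p) (_hpn : p < n) (_hd : 1 ≤ d)
        (I : Ideal (MvPolynomial (Fin n) K)) (_hI : IsGenericDeterminantal p d I)
        (G : List (MvPolynomial (Fin n) K)) (_hGn : G.Nodup)
        (_hG : IsReducedGroebnerBasis (drl n) {g | g ∈ G} I),
        ∃ B : Module.Basis (staircase (drl n) {g | g ∈ G}) K (MvPolynomial (Fin n) K ⧸ I),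
          (∀ b, B b = Ideal.Quotient.mk I (MvPolynomial.monomial b.1 1)) ∧
          (∀ b : staircase (drl n) {g | g ∈ G},
            (∃ c : staircase (drl n) {g | g ∈ G},
              c.1 = b.1 + Finsupp.single (lastVar n) 1 ∧
              (multMatrix B c b = 1 ∧ ∀ a, a ≠ c → multMatrix B a b = 0)) ∨
            (∃ g ∈ G, (drl n).degree g = b.1 + Finsupp.single (lastVar n) 1 ∧
              ∀ a, multMatrix B a b = - g.coeff a.1)) ∧
          A.Constructs G (multMatrix B) ∧
          A.arithOps (monData G) = 0 := by
  refine ⟨copyAlgorithm, ?_⟩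
  intro K _ _ n p d _ _ _ _ I hI G _ hG
  classical
  have h0 : ∀ g ∈ G, g ≠ 0 := fun g hg => by
    have := hG.2.1 g hg
    rintro rfl
    simp at this
  have hS := staircase_eq_stdMons hG.1 h0
  -- Shape position includes finite dimension, and the staircase indexes a basis.
  have hfin : (staircase (drl n) {g | g ∈ G}).Finite := by
    have := hI.shape.choose_spec.2.1
    have := Module.Finite.finite_basis (stdBasis hS)
    exact Set.toFinite _
  have hcases : ∀ b : staircase (drl n) {g | g ∈ G},
      b.1 + Finsupp.single (lastVar n) 1 ∉ staircase (drl n) {g | g ∈ G} →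
      ∃ g ∈ G, (drl n).degree g = b.1 + Finsupp.single (lastVar n) 1 := by
    intro b hb
    simp only [staircase, Set.mem_ofPred_eq, not_forall, not_not] at hb
    obtain ⟨g, hg, hle⟩ := hb
    exact ⟨g, hg, mem_or_isMinimal hI.froberg (hS ▸ b.2)
      (fun h => h g (hG.1.2.1 hg) (h0 g hg) rfl) hle⟩
  refine ⟨stdBasis hS, stdBasis_apply hS, fun b => ?_, ⟨?_, ?_, fun a b => ?_⟩,
    arithOps_copyAlgorithm _⟩
  · by_cases hb : b.1 + Finsupp.single (lastVar n) 1 ∈ staircase (drl n) {g | g ∈ G}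
    · refine Or.inl ⟨⟨_, hb⟩, rfl, ?_, fun a ha => ?_⟩
      · rw [multMatrix_of_mem hS _ b ⟨_, hb⟩ rfl, if_pos rfl]
      · rw [multMatrix_of_mem hS _ b ⟨_, hb⟩ rfl, if_neg ha]
    · obtain ⟨g, hg, hgb⟩ := hcases b hb
      exact Or.inr ⟨g, hg, hgb, fun a => multMatrix_of_degree_eq hS hG rfl hg a b hgb⟩
  · exact (nodup_boxLists _ _).filter _
  · exact mem_stdIndex h0 hfin
  · refine progOutput_copyEntry h0 a.1 b.1 _ (fun hno => ?_)
      fun g hg hgb => multMatrix_of_degree_eq hS hG rfl hg a b hgb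
    have hb : b.1 + Finsupp.single (lastVar n) 1 ∈ staircase (drl n) {g | g ∈ G} := by
      by_contra hb
      obtain ⟨g, hg, hgb⟩ := hcases b hb
      exact hno g hg hgb
    rw [multMatrix_of_mem hS a b ⟨_, hb⟩ rfl]
    exact if_congr Subtype.ext_iff rfl rfl
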